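/- A \emph{geometric universe} is a cartesian closed category with finite limits, a subobject classifier $\Omega$ and a natural numbers object. A \emph{left exact localization} $L : \mathcal S \to \mathcal T$ of geometric universes is a left exact functor $L^* : \mathcal S \to \mathcal T$ together with a fully faithful right adjoint $\Gamma_L : \mathcal T \to \mathcal S$; write $\epsilon : L^*\Gamma_L \to \mathrm{Id}_{\mathcal T}$ for the (invertible) counit. A \emph{later modality structure} on $\mathcal S$ is a left exact endofunctor $\triangleright : \mathcal S \to \mathcal S$ with a natural transformation $\mathrm{next} : \mathrm{Id}_{\mathcal S} \to \triangleright$. It is \emph{well-pointed} if $\mathrm{next}_{\triangleright A} = \triangleright(\mathrm{next}_A)$ for every object $A$. It \emph{supports Löb induction} if the sequent $\phi : \Omega \mid (\triangleright\phi \Rightarrow \phi) \vdash \phi$ holds in the internal logic of $\mathcal S$, where $\triangleright : \Omega \to \Omega$ is the composite of $\mathrm{next}_\Omega : \Omega \to \triangleright\Omega$ with the characteristic map $\triangleright\Omega \to \Omega$ of the monomorphism $\triangleright(\mathrm{true}) : \triangleright 1 \to \triangleright\Omega$. An \emph{elementary geometric model} of synthetic guarded domain theory is a geometric universe equipped with a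 well-pointed later modality structure that supports Löb induction. Given a left exact localization $L : \mathcal S \to \mathcal T$ and a later modality structure $(\triangleright, \mathrm{next})$ on $\mathcal S$, define a later modality structure $(\triangleright_L, \mathrm{next}_L)$ on $\mathcal T$ by $\triangleright_L A = L^*(\triangleright(\Gamma_L A))$ and $\mathrm{next}_{L,A} = L^*(\mathrm{next}_{\Gamma_L A}) \circ \epsilon_A^{-1} : A \to \triangleright_L A$. \textbf{Theorem (Stability under localization).} If $(\triangleright, \mathrm{next})$ on $\mathcal S$ supports Löb induction, then so does $(\triangleright_L, \mathrm{next}_L)$ on $\mathcal T$, for every left exact localization $L : \mathcal S \to \mathcal T$. Moreover, if $\mathcal S$ with $(\triangleright, \mathrm{next})$ is an elementary geometric model of synthetic guarded domain theory, then so is $\mathcal T$ with $(\triangleright_L, \mathrm{next}_L)$. -/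

import Mathlib

open CategoryTheory CategoryTheory.Limits CategoryTheory.MonoidalCategory
open CategoryTheory.CartesianMonoidalCategory

universe v v₁ v₂ u u₁ u₂

noncomputable section

/-- A natural numbers object: a diagram `1 ⟶ N ⟶ N` that is initial among all diagrams
`1 ⟶ X ⟶ X`. -/
structure NaturalNumbersObject (E : Type u) [Category.{v} E] [CartesianMonoidalCategory E] where
  N : E
  zero : 𝟙_ E ⟶ N
  succ : N ⟶ N
  existsUnique_rec {X : E} (x : 𝟙_ E ⟶ X) (f : X ⟶ X) :
    ∃! r : N ⟶ X, zero ≫ r = x ∧ succ ≫ r = r ≫ f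

/-- A geometric universe (elementary topos with natural numbers object): a cartesian closed
category with finite limits, a subobject classifier and a natural numbers object. -/
class GeometricUniverse (E : Type u) [Category.{v} E] extends
    CartesianMonoidalCategory E, MonoidalClosed E where
  hasFiniteLimits : HasFiniteLimits E
  classifier : Subobject.Classifier E
  nno : NaturalNumbersObject E

attribute [instance] GeometricUniverse.hasFiniteLimits

/-! ### The internal logic of a geometric universe -/

namespace GeometricUniverse

variable (E : Type u) [Category.{v} E] [GeometricUniverse E]

/-- The object of truth values. -/
abbrev Ω : E := (classifier (E := E)).Ω

/-- The domain of the generic subobject (a terminal object). -/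
abbrev Ω₀ : E := (classifier (E := E)).Ω₀

/-- The generic subobject `true : 1 ⟶ Ω`. -/
abbrev truth : Ω₀ E ⟶ Ω E := (classifier (E := E)).truth

instance : Mono (truth E) := (classifier (E := E)).mono_truth

variable {E} in
/-- The characteristic map of a monomorphism. -/
abbrev χ {U X : E} (m : U ⟶ X) [Mono m] : X ⟶ Ω E := (classifier (E := E)).χ m

instance : Mono (lift (truth E) (truth E)) :=
  mono_of_mono_fac (lift_fst (truth E) (truth E))

/-- Internal conjunction `Ω × Ω ⟶ Ω`: the characteristic map of `(true, true)`. -/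
def conj : Ω E ⊗ Ω E ⟶ Ω E := χ (lift (truth E) (truth E))

/-- Internal implication `Ω × Ω ⟶ Ω`: the characteristic map of the order relation
`{(φ, ψ) | φ ∧ ψ = φ}`. -/
def impl : Ω E ⊗ Ω E ⟶ Ω E := χ (equalizer.ι (conj E) (fst (Ω E) (Ω E)))

variable {E}

/-- The subobject `{x : X | φ x}` defined by a formula `φ` in context `X`. -/
def extent {X : E} (φ : X ⟶ Ω E) : Subobject X :=
  (Subobject.pullback φ).obj (Subobject.mk (truth E))

/-- Validity of the sequent `x : X | φ x ⊢ ψ x` in the internal logic. -/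
def Entails {X : E} (φ ψ : X ⟶ Ω E) : Prop := extent φ ≤ extent ψ

end GeometricUniverse

/-! ### Morphisms of geometric universes and left exact localizations -/

/-- A morphism `S ⟶ T` of geometric universes: a left exact functor `S ⥤ T` together with a right
adjoint. -/
structure GeometricUniverse.Morphism (S : Type u₁) [Category.{v₁} S] [GeometricUniverse S]
    (T : Type u₂) [Category.{v₂} T] [GeometricUniverse T] where
  /-- The left exact functor. -/
  inverse : S ⥤ T
  /-- Its right adjoint. -/
  direct : T ⥤ S
  adj : inverse ⊣ direct
  leftExact : PreservesFiniteLimits inverse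

/-- A left exact localization of `S`: a morphism `S ⟶ T` of geometric universes whose right adjoint
is fully faithful. -/
structure LexLocalization (S : Type u₁) [Category.{v₁} S] [GeometricUniverse S]
    (T : Type u₂) [Category.{v₂} T] [GeometricUniverse T] extends
    GeometricUniverse.Morphism S T where
  full : direct.Full
  faithful : direct.Faithful

attribute [instance] GeometricUniverse.Morphism.leftExact LexLocalization.full
  LexLocalization.faithful

/-! ### Later modalities -/

/-- A later modality structure: a left exact endofunctor `▷` with a natural transformation
`next : Id ⟶ ▷`. -/
structure LaterModality (S : Type u) [Category.{v} S] [GeometricUniverse S] where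
  later : S ⥤ S
  leftExact : PreservesFiniteLimits later
  next : 𝟭 S ⟶ later

attribute [instance] LaterModality.leftExact

namespace LaterModality

open GeometricUniverse

section

variable {S : Type u} [Category.{v} S] [GeometricUniverse S] (M : LaterModality S)

/-- Well-pointedness: the two whiskerings `▷ ⟶ ▷▷` of `next` by `▷` coincide. -/
def WellPointed : Prop :=
  ∀ A : S, M.next.app (M.later.obj A) = M.later.map (M.next.app A)

/-- The later modality internalized on truth values. The monomorphism `▷ true : ▷ 1 ⟶ ▷ Ω` has a
characteristic map `▷ Ω ⟶ Ω`, which is composed with `next : Ω ⟶ ▷ Ω`. -/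
def laterProp : Ω S ⟶ Ω S := M.next.app (Ω S) ≫ χ (M.later.map (truth S))

/-- Löb induction: the sequent `φ : Ω | ▷ φ ⇒ φ ⊢ φ` holds in the internal logic. -/
def SupportsLoeb : Prop :=
  Entails (lift M.laterProp (𝟙 (Ω S)) ≫ impl S) (𝟙 (Ω S))

/-- `S` with the later modality structure `M` is an elementary geometric model of synthetic guarded
domain theory. -/
structure IsElementaryGeometricModel : Prop where
  wellPointed : M.WellPointed
  supportsLoeb : M.SupportsLoeb

end

section

variable {S : Type u₁} [Category.{v₁} S] [GeometricUniverse S]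
  {T : Type u₂} [Category.{v₂} T] [GeometricUniverse T]

/-- The localized later modality: the endofunctor of `T` is the direct image followed by `▷`
followed by the inverse image, and its point at `A` is the inverse of the counit at `A` followed by
the inverse image of `next` at the direct image of `A`. -/
def localize (M : LaterModality S) (L : LexLocalization S T) : LaterModality T where
  later := L.direct ⋙ M.later ⋙ L.inverse
  leftExact := by
    have := L.adj.rightAdjoint_preservesLimits
    infer_instance
  next :=
    { app := fun A => inv (L.adj.counit.app A) ≫ L.inverse.map (M.next.app (L.direct.obj A))
      naturality := fun A B f => by
        have h := M.next.naturality (L.direct.map f)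
        have k := L.adj.counit.naturality f
        simp only [Functor.id_map, Functor.id_obj, Functor.comp_map, Functor.comp_obj] at h k ⊢
        rw [Category.assoc, ← L.inverse.map_comp, ← h, L.inverse.map_comp, ← Category.assoc,
          ← Category.assoc]
        congr 1
        rw [IsIso.eq_inv_comp, ← Category.assoc, ← k, Category.assoc, IsIso.hom_inv_id,
          Category.comp_id] }

end

end LaterModality

end

/-! By Kripke–Joyal semantics, Löb induction is external: a mono `m` into `X` containing the
pullback of `▷ m` along `next` is split epi (`supportsLoeb_iff`). For such an `m` in `T`, adjoint
transposition shows that `Γ m` has the same closure property in `S`; Löb induction in `S` then gives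
a section of `Γ m`, which descends because `Γ` is fully faithful. Well-pointedness reduces to that
of `S`, since both sides are `L^*` of maps in `S` computed from the unit. -/

namespace GeometricUniverse

section

variable {E : Type u} [Category.{v} E] [GeometricUniverse E]

/-- A truth value at stage `X` is true when it factors through the generic subobject. -/
def IsTrue {X : E} (φ : X ⟶ Ω E) : Prop := ∃ t : X ⟶ Ω₀ E, t ≫ truth E = φ

lemma isTrue_comp_χ_iff {U X Z : E} (m : U ⟶ X) [Mono m] (f : Z ⟶ X) :
    IsTrue (f ≫ χ m) ↔ ∃ h : Z ⟶ U, h ≫ m = f := by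
  have sq := (classifier (E := E)).isPullback m
  constructor
  · rintro ⟨t, ht⟩
    exact ⟨sq.lift f t ht.symm, sq.lift_fst _ _ _⟩
  · rintro ⟨h, rfl⟩
    exact ⟨h ≫ (classifier (E := E)).χ₀ U, by simp [sq.w]⟩

lemma isTrue_χ_iff {U X : E} (m : U ⟶ X) [Mono m] :
    IsTrue (χ m) ↔ ∃ h : X ⟶ U, h ≫ m = 𝟙 X := by
  simpa using isTrue_comp_χ_iff m (𝟙 X)

/-- Every truth value is the characteristic map of the subobject it cuts out. -/
lemma χ_pullback_fst {X : E} (φ : X ⟶ Ω E) : χ (pullback.fst φ (truth E)) = φ :=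
  ((classifier (E := E)).uniq _ (IsPullback.of_hasPullback φ (truth E))).symm

/-- Truth values at stage `X` with the same true restrictions are equal. -/
lemma hom_Ω_ext {X : E} {φ ψ : X ⟶ Ω E}
    (h : ∀ (Z : E) (f : Z ⟶ X), IsTrue (f ≫ φ) ↔ IsTrue (f ≫ ψ)) : φ = ψ := by
  -- The subobject cut out by `φ` is also a pullback of `truth` along `ψ`, so uniqueness of
  -- characteristic maps applies.
  obtain ⟨s, hs⟩ := (h _ (pullback.fst φ (truth E))).1 ⟨_, pullback.condition.symm⟩
  rw [← χ_pullback_fst φ]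
  refine ((classifier (E := E)).uniq _ (χ₀' := s) (IsPullback.of_isLimit' ⟨hs.symm⟩
    (PullbackCone.IsLimit.mk _ (fun c => pullback.lift c.fst ((h _ c.fst).2 ⟨c.snd,
      c.condition.symm⟩).choose ((h _ c.fst).2 ⟨c.snd, c.condition.symm⟩).choose_spec.symm)
      (fun c => pullback.lift_fst _ _ _) (fun c => ?_) (fun c l hl _ => ?_)))).symm
  · rw [← cancel_mono (truth E), Category.assoc, hs, pullback.lift_fst_assoc, c.condition]
  · rw [← cancel_mono (pullback.fst φ (truth E)), hl, pullback.lift_fst]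

lemma isTrue_lift_conj_iff {X : E} (φ ψ : X ⟶ Ω E) :
    IsTrue (lift φ ψ ≫ conj E) ↔ IsTrue φ ∧ IsTrue ψ := by
  rw [conj, isTrue_comp_χ_iff]
  constructor
  · rintro ⟨h, hh⟩
    exact ⟨⟨h, by simpa using hh =≫ fst _ _⟩, ⟨h, by simpa using hh =≫ snd _ _⟩⟩
  · rintro ⟨⟨s, rfl⟩, ⟨t, rfl⟩⟩
    have hst : s = t := (classifier (E := E)).isTerminalΩ₀.hom_ext _ _
    exact ⟨s, by rw [comp_lift, hst]⟩

/-- Kripke–Joyal semantics of implication. -/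
lemma isTrue_lift_impl_iff {X : E} (φ ψ : X ⟶ Ω E) :
    IsTrue (lift φ ψ ≫ impl E) ↔
      ∀ (Z : E) (f : Z ⟶ X), IsTrue (f ≫ φ) → IsTrue (f ≫ ψ) := by
  have key : IsTrue (lift φ ψ ≫ impl E) ↔ lift φ ψ ≫ conj E = φ := by
    rw [impl, isTrue_comp_χ_iff]
    constructor
    · rintro ⟨h, hh⟩
      rw [← hh, Category.assoc, equalizer.condition, ← Category.assoc, hh, lift_fst]
    · intro h
      exact ⟨equalizer.lift (lift φ ψ) (by rw [h, lift_fst]), equalizer.lift_ι _ _⟩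
  rw [key]
  constructor
  · intro h Z f hf
    rw [← h, ← Category.assoc, comp_lift, isTrue_lift_conj_iff] at hf
    exact hf.2
  · intro h
    refine hom_Ω_ext fun Z f => ?_
    rw [← Category.assoc, comp_lift, isTrue_lift_conj_iff]
    exact ⟨And.left, fun hf => ⟨hf, h Z f hf⟩⟩

lemma factors_extent_iff {X Z : E} (φ : X ⟶ Ω E) (f : Z ⟶ X) :
    (extent φ).Factors f ↔ IsTrue (f ≫ φ) := by
  rw [extent, Subobject.pullback_obj_mk (IsPullback.of_hasPullback φ (truth E)).flip,
    Subobject.mk_factors_iff]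
  conv_rhs => rw [← χ_pullback_fst φ]
  exact (isTrue_comp_χ_iff _ f).symm

lemma entails_iff {X : E} (φ ψ : X ⟶ Ω E) :
    Entails φ ψ ↔ ∀ (Z : E) (f : Z ⟶ X), IsTrue (f ≫ φ) → IsTrue (f ≫ ψ) := by
  simp only [← factors_extent_iff]
  constructor
  · intro h Z f hf
    exact Subobject.factors_of_le f h hf
  · intro h
    -- The hypothesis is tested on the generic element, the inclusion of `extent φ`.
    exact Subobject.le_of_comm (Subobject.factorThru _ _ (h _ _ (Subobject.factors_self _)))
      (Subobject.factorThru_arrow _ _ _)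

end

end GeometricUniverse

namespace LaterModality

open GeometricUniverse

section

variable {S : Type u} [Category.{v} S] [GeometricUniverse S] (M : LaterModality S)

/-- Naturality moves `next` in front of `χ m`, and left exactness of `▷` makes `▷ m` the pullback of
`▷ true` along `▷ (χ m)`. -/
lemma isTrue_comp_χ_laterProp_iff {U X Z : S} (m : U ⟶ X) [Mono m] (f : Z ⟶ X) :
    IsTrue (f ≫ χ m ≫ M.laterProp) ↔
      ∃ g : Z ⟶ M.later.obj U, g ≫ M.later.map m = f ≫ M.next.app X := by
  have nat := M.next.naturality (χ m)
  have sq := ((classifier (E := S)).isPullback m).map M.later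
  simp only [Functor.id_map] at nat
  rw [laterProp, reassoc_of% nat, ← Category.assoc, ← Category.assoc, isTrue_comp_χ_iff]
  constructor
  · rintro ⟨h, hh⟩
    exact ⟨sq.lift _ h hh.symm, sq.lift_fst _ _ _⟩
  · rintro ⟨g, hg⟩
    exact ⟨g ≫ M.later.map ((classifier (E := S)).χ₀ U), by rw [← hg, Category.assoc,
      Category.assoc, sq.w]⟩

/-- Löb induction, externally: a subobject `m` of `X` which contains the pullback of `▷ m` along
`next` is all of `X`. -/
lemma supportsLoeb_iff : M.SupportsLoeb ↔
    ∀ (U X : S) (m : U ⟶ X) [Mono m],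
      (∀ (Z : S) (f : Z ⟶ X), (∃ g, g ≫ M.later.map m = f ≫ M.next.app X) →
        ∃ h : Z ⟶ U, h ≫ m = f) → ∃ s : X ⟶ U, s ≫ m = 𝟙 X := by
  have impl_iff (X : S) (φ : X ⟶ Ω S) :
      IsTrue (φ ≫ lift M.laterProp (𝟙 (Ω S)) ≫ impl S) ↔
        ∀ (Z : S) (f : Z ⟶ X), IsTrue (f ≫ φ ≫ M.laterProp) → IsTrue (f ≫ φ) := by
    rw [← Category.assoc, comp_lift, isTrue_lift_impl_iff, Category.comp_id]
  simp only [SupportsLoeb, entails_iff, impl_iff, Category.comp_id]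
  constructor
  · intro H U X m _ hm
    refine (isTrue_χ_iff m).1 (H X (χ m) fun Z f hf => ?_)
    rw [isTrue_comp_χ_iff]
    exact hm Z f ((M.isTrue_comp_χ_laterProp_iff m f).1 hf)
  · intro H X φ hφ
    rw [← χ_pullback_fst φ] at hφ ⊢
    refine (isTrue_χ_iff _).2 (H _ _ _ fun Z f hf => ?_)
    exact (isTrue_comp_χ_iff _ f).1 (hφ Z f ((M.isTrue_comp_χ_laterProp_iff _ f).2 hf))

end

section

variable {S : Type u₁} [Category.{v₁} S] [GeometricUniverse S]
  {T : Type u₂} [Category.{v₂} T] [GeometricUniverse T]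
  (L : LexLocalization S T) {M : LaterModality S}

lemma localize_later_map {A B : T} (f : A ⟶ B) :
    (M.localize L).later.map f = L.inverse.map (M.later.map (L.direct.map f)) := rfl

lemma counit_comp_localize_next (A : T) :
    L.adj.counit.app A ≫ (M.localize L).next.app A =
      L.inverse.map (M.next.app (L.direct.obj A)) := by
  simp [localize]

lemma SupportsLoeb.localize (hM : M.SupportsLoeb) : (M.localize L).SupportsLoeb := by
  rw [supportsLoeb_iff] at hM ⊢
  intro U X m _ hm
  have := L.adj.rightAdjoint_preservesLimits
  obtain ⟨s, hs⟩ := hM _ _ (L.direct.map m) fun Z f ⟨g, hg⟩ => by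
    -- The hypothesis on `m` is applied to the transpose of `f`, with witness `L^* g`; transposing
    -- `h` back factors `f` through `Γ m`.
    obtain ⟨h, hh⟩ := hm (L.inverse.obj Z) (L.inverse.map f ≫ L.adj.counit.app X)
      ⟨L.inverse.map g, by
        rw [Category.assoc, counit_comp_localize_next]
        exact (L.inverse.map_comp _ _).symm.trans
          ((congrArg L.inverse.map hg).trans (L.inverse.map_comp _ _))⟩
    refine ⟨L.adj.homEquiv _ _ h, ?_⟩
    rw [← L.adj.homEquiv_naturality_right, hh, ← L.adj.homEquiv_counit, Equiv.apply_symm_apply]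
  exact ⟨L.direct.preimage s, L.direct.map_injective (by simpa using hs)⟩

/-- By a triangle identity, the inverse counit at `L^* X` is `L^*` of the unit. -/
lemma localize_next_inverse_obj (X : S) :
    (M.localize L).next.app (L.inverse.obj X) =
      L.inverse.map (M.next.app X ≫ M.later.map (L.adj.unit.app X)) := by
  have inv_counit : inv (L.adj.counit.app (L.inverse.obj X)) = L.inverse.map (L.adj.unit.app X) :=
    IsIso.inv_eq_of_inv_hom_id (L.adj.left_triangle_components X)
  have h : inv (L.adj.counit.app (L.inverse.obj X)) ≫
        L.inverse.map (M.next.app (L.direct.obj (L.inverse.obj X))) =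
      L.inverse.map (L.adj.unit.app X ≫ M.next.app (L.direct.obj (L.inverse.obj X))) := by
    rw [inv_counit]
    exact (L.inverse.map_comp _ _).symm
  exact h.trans (congrArg L.inverse.map (M.next.naturality (L.adj.unit.app X)))

lemma direct_map_localize_next (A : T) :
    L.direct.map ((M.localize L).next.app A) =
      M.next.app (L.direct.obj A) ≫ L.adj.unit.app (M.later.obj (L.direct.obj A)) := by
  have h : L.direct.map ((M.localize L).next.app A) = L.adj.unit.app (L.direct.obj A) ≫
      L.direct.map (L.adj.counit.app A ≫ (M.localize L).next.app A) := by
    rw [L.direct.map_comp, L.adj.right_triangle_components_assoc]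
  rw [counit_comp_localize_next] at h
  exact h.trans (L.adj.unit.naturality (M.next.app (L.direct.obj A))).symm

lemma WellPointed.localize (hM : M.WellPointed) : (M.localize L).WellPointed := by
  intro A
  -- Both sides of the goal are `L^*` of the two sides of this equation.
  have h : M.next.app (M.later.obj (L.direct.obj A)) ≫
        M.later.map (L.adj.unit.app (M.later.obj (L.direct.obj A))) =
      M.later.map (M.next.app (L.direct.obj A) ≫
        L.adj.unit.app (M.later.obj (L.direct.obj A))) := by
    rw [hM]
    exact (M.later.map_comp _ _).symm
  exact (localize_next_inverse_obj L _).trans (congrArg L.inverse.map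
    (h.trans (congrArg M.later.map (direct_map_localize_next L A).symm)))

end

end LaterModality

theorem mainTheorem8
    {S : Type u₁} [Category.{v₁} S] [GeometricUniverse S]
    {T : Type u₂} [Category.{v₂} T] [GeometricUniverse T]
    (L : LexLocalization S T) (M : LaterModality S) :
    (M.SupportsLoeb → (M.localize L).SupportsLoeb) ∧
      (M.IsElementaryGeometricModel → (M.localize L).IsElementaryGeometricModel) :=
  ⟨fun h => h.localize L, fun h => ⟨h.wellPointed.localize L, h.supportsLoeb.localize L⟩⟩
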